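/- There is a universal constant $C \ge 1$ such that the following holds. Let $A, B$ be finite sets, let $\Delta \in \mathbb{N}$, and let $\mathbf{M} \in \{0,1,\dots,\Delta\}^{A \times B}$ be a matrix whose rank over $\mathbb{R}$ is $r \ge 2$. Then there are $A' \subseteq A$ and $B' \subseteq B$ such that at least a $\left(1-\frac{1}{16r}\right)$-fraction of the entries of the submatrix $\mathbf{M}[A',B']$ have the same value, and $$|A'|\,|B'| \;\ge\; |A|\,|B| \cdot \exp\!\left(-C\,\Delta^{C\Delta}\,\sqrt{r}\,\log r\right).$$ -/

import Mathlib

/-- The rectangle `M[A', B']` is `(1 - ε)`-monochromatic: at least a `(1 - ε)`-fraction of its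
entries have the same value. -/
def IsAlmostMonochromatic {A B α : Type*} [DecidableEq α] (M : Matrix A B α)
    (A' : Finset A) (B' : Finset B) (ε : ℝ) : Prop :=
  ∃ c : α, (1 - ε) * ((A'.card : ℝ) * (B'.card : ℝ)) ≤
    (((A' ×ˢ B').filter (fun p => M p.1 p.2 = c)).card : ℝ)

/-! Bounded low rank yields geometry: the entries of `M`, divided by `Δ * √r`, are inner products of
vectors in the unit ball (`Matrix.exists_inner_eq_div_of_rank`, via a D-optimal design). A random
Gaussian direction and a random phase then give random `[0, 1]`-weights on rows and columns whose
product has expectation `roundingWeight`, an increasing function of the inner product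
(`exists_rounding`). After `T` rounds, the share of each value is tilted by the `T`-th power of its
weight. Consecutive weights differ by a factor `1 + c / (Δ * √r)`, so about `Δ ^ 2 * √r * log r`
rounds spread the values by a factor polynomial in `Δ` and `r`. Two values can be comparable for at
most one multiple of that many rounds, so some multiple leaves one value `m` dominant
(`exists_dominating_tilt`). Scoring `m`-entries by `1` and all others by `-K` gives a large expected
score; bilinearity supplies a rectangle scoring as well. Each round costs at most a factor 4 in
size. -/

/-! ### Factorization through the unit ball -/

open Matrix in
/-- A real matrix of rank `r` factors through `Fin r`, with a left factor of full column rank. -/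
theorem Matrix.exists_rank_factorization {A B : Type*} [Fintype A] [Fintype B]
    (M : Matrix A B ℝ) {r : ℕ} (hr : M.rank = r) :
    ∃ (X : Matrix A (Fin r) ℝ) (Y : Matrix (Fin r) B ℝ),
      M = X * Y ∧ Function.Injective X.mulVec := by
  classical
  let b : Module.Basis (Fin r) ℝ (LinearMap.range M.mulVecLin) :=
    Module.finBasisOfFinrankEq ℝ _ hr
  have hmem (j : B) : M.mulVecLin (Pi.single j 1) ∈ LinearMap.range M.mulVecLin :=
    LinearMap.mem_range_self _ _
  have hX (c : Fin r → ℝ) : (Matrix.of fun a i => (b i : A → ℝ) a) *ᵥ c =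
      ((∑ i, c i • b i : LinearMap.range M.mulVecLin) : A → ℝ) := by
    ext a
    simp [Matrix.mulVec, dotProduct, mul_comm]
  refine ⟨Matrix.of fun a i => (b i : A → ℝ) a,
    Matrix.of fun i j => b.repr ⟨_, hmem j⟩ i, ?_, ?_⟩
  · ext a j
    have h := congrFun (hX fun i => b.repr ⟨_, hmem j⟩ i) a
    rw [b.sum_repr] at h
    simp only [Matrix.mulVecLin_apply, Matrix.mulVec_single_one] at h
    rw [Matrix.col_apply] at h
    rw [← h]
    simp [Matrix.mul_apply, Matrix.mulVec, dotProduct]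
  · intro c d hcd
    rw [hX, hX] at hcd
    refine b.equivFun.symm.injective ?_
    rw [b.equivFun_symm_apply, b.equivFun_symm_apply]
    exact Subtype.ext hcd

open Matrix in
/-- The determinant of a rank-one update of a multiple of a Gram matrix. -/
theorem Matrix.det_smul_gram_add_smul_vecMulVec {n : Type*} [Fintype n] [DecidableEq n]
    (B : Matrix n n ℝ) (z : n → ℝ) {t : ℝ} (ht : t < 1) :
    ((1 - t) • (Bᵀ * B) + t • vecMulVec (Bᵀ *ᵥ z) (Bᵀ *ᵥ z)).det =
      (Bᵀ * B).det * ((1 - t) ^ Fintype.card n * (1 + t / (1 - t) * (z ⬝ᵥ z))) := by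
  have h1 : (1 - t) ≠ 0 := by linarith
  have key : (1 - t) • (Bᵀ * B) + t • vecMulVec (Bᵀ *ᵥ z) (Bᵀ *ᵥ z) =
      Bᵀ * ((1 - t) • (1 + replicateCol Unit ((t / (1 - t)) • z) * replicateRow Unit z)) * B := by
    rw [← vecMulVec_eq, smul_vecMulVec, smul_add, smul_smul, mul_div_cancel₀ _ h1,
      Matrix.mul_add, Matrix.add_mul, Matrix.mul_smul, Matrix.smul_mul, Matrix.mul_one,
      Matrix.mul_smul, Matrix.smul_mul, mul_vecMulVec, vecMulVec_mul, mulVec_transpose]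
  rw [key, det_mul, det_mul, det_smul, det_one_add_replicateCol_mul_replicateRow, dotProduct_smul,
    det_mul]
  simp only [smul_eq_mul]
  ring

/-- Along the segment towards a heavy rank-one matrix the determinant initially increases. -/
theorem exists_one_lt_one_sub_pow_mul {r : ℕ} {q : ℝ} (hq : (r : ℝ) < q) :
    ∃ t : ℝ, 0 < t ∧ t < 1 ∧ 1 < (1 - t) ^ r * (1 + t / (1 - t) * q) := by
  have hr : (0 : ℝ) ≤ r := Nat.cast_nonneg r
  -- By Bernoulli it suffices that `(1 - r * t) * (1 + t * q) > 1`, which for `t > 0` is exactly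
  -- this inequality.
  obtain ⟨t, ht0, ht1, ht⟩ : ∃ t : ℝ, 0 < t ∧ t < 1 ∧ t * ((r : ℝ) * q) < q - r := by
    have hpos : 0 < 1 + r * q := by nlinarith
    refine ⟨min (1 / 2) ((q - r) / (1 + r * q)), ?_, ?_, ?_⟩
    · exact lt_min (by norm_num) (div_pos (by linarith) hpos)
    · exact (min_le_left _ _).trans_lt (by norm_num)
    · have h2 : min (1 / 2) ((q - r) / (1 + r * q)) * (1 + r * q) ≤ q - r := by
        calc _ ≤ (q - r) / (1 + r * q) * (1 + r * q) := by gcongr; exact min_le_right _ _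
          _ = q - r := div_mul_cancel₀ _ hpos.ne'
      have h3 : 0 < min (1 / 2) ((q - r) / (1 + r * q)) :=
        lt_min (by norm_num) (div_pos (by linarith) hpos)
      nlinarith
  refine ⟨t, ht0, ht1, ?_⟩
  have hb : 1 - r * t ≤ (1 - t) ^ r := by
    have := one_add_mul_le_pow (a := -t) (by linarith) r
    calc 1 - r * t = 1 + r * (-t) := by ring
      _ ≤ _ := this
  have hd : t ≤ t / (1 - t) := le_div_self ht0.le (by linarith) (by linarith)
  have hqt : 1 + t * q ≤ 1 + t / (1 - t) * q := by
    have : 0 ≤ q := by linarith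
    gcongr
  calc 1 < (1 - r * t) * (1 + t * q) := by nlinarith
    _ ≤ (1 - t) ^ r * (1 + t * q) := by
        gcongr
        nlinarith
    _ ≤ _ := by
        have : 0 ≤ (1 - t) ^ r := pow_nonneg (by linarith) _
        gcongr

open Matrix in
/-- Existence of a D-optimal design: for suitable weights `l` on the rows of `X`, the
weighted covariance matrix is `Bᵀ * B` with `B` invertible, and each row has squared
Mahalanobis norm at most the dimension. -/
theorem Matrix.exists_optimal_design {A : Type*} [Fintype A] [Nonempty A] {r : ℕ}
    (X : Matrix A (Fin r) ℝ) (hX : Function.Injective X.mulVec) :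
    ∃ (l : A → ℝ) (B : Matrix (Fin r) (Fin r) ℝ) (z : A → Fin r → ℝ),
      l ∈ stdSimplex ℝ A ∧ IsUnit B.det ∧
      (∀ y : Fin r → ℝ, (B *ᵥ y) ⬝ᵥ (B *ᵥ y) = ∑ a, l a * (X a ⬝ᵥ y) ^ 2) ∧
      (∀ a, Bᵀ *ᵥ z a = X a) ∧ ∀ a, z a ⬝ᵥ z a ≤ r := by
  classical
  let S : (A → ℝ) → Matrix (Fin r) (Fin r) ℝ := fun l => ∑ a, l a • vecMulVec (X a) (X a)
  have hquad (l : A → ℝ) (y : Fin r → ℝ) :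
      y ⬝ᵥ (S l *ᵥ y) = ∑ a, l a * (X a ⬝ᵥ y) ^ 2 := by
    simp only [S, Matrix.sum_mulVec, dotProduct_sum, smul_mulVec, dotProduct_smul,
      vecMulVec_mulVec, smul_eq_mul]
    refine Finset.sum_congr rfl fun a _ => ?_
    simp [dotProduct_comm y, pow_two]
  have hherm (l : A → ℝ) : (S l).IsHermitian := by
    ext i j
    simp [S, Matrix.sum_apply, vecMulVec_apply, mul_comm]
  have hpsd {l : A → ℝ} (hl : l ∈ stdSimplex ℝ A) : (S l).PosSemidef := by
    refine .of_dotProduct_mulVec_nonneg (hherm l) fun y => ?_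
    rw [star_trivial, hquad]
    exact Finset.sum_nonneg fun a _ => mul_nonneg (hl.1 a) (sq_nonneg _)
  have hcont : Continuous fun l => (S l).det := by
    refine Continuous.matrix_det ?_
    exact continuous_finsetSum _ fun a _ => (continuous_apply a).smul continuous_const
  -- The design maximizes the determinant; uniform weights show below that the maximum is positive,
  -- since `X` has full column rank.
  obtain ⟨l, hl, hmax⟩ := (isCompact_stdSimplex ℝ A).exists_isMaxOn
    ⟨_, single_mem_stdSimplex ℝ (Classical.arbitrary A)⟩ hcont.continuousOn
  have hpos : 0 < (S l).det := by
    let l₀ : A → ℝ := fun _ => (Fintype.card A : ℝ)⁻¹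
    have hc : (0 : ℝ) < Fintype.card A := by exact_mod_cast Fintype.card_pos
    have hl₀ : l₀ ∈ stdSimplex ℝ A := ⟨fun _ => by positivity, by simp [l₀, hc.ne']⟩
    refine lt_of_lt_of_le ?_ (hmax hl₀)
    refine Matrix.PosDef.det_pos (.of_dotProduct_mulVec_pos (hherm l₀) fun y hy => ?_)
    rw [star_trivial, hquad]
    have hXy : X *ᵥ y ≠ 0 := fun h => hy (hX (by rw [h, mulVec_zero]))
    obtain ⟨a, ha⟩ := Function.ne_iff.1 hXy
    refine Finset.sum_pos' (fun _ _ => by positivity) ⟨a, Finset.mem_univ a, ?_⟩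
    have : X a ⬝ᵥ y ≠ 0 := ha
    positivity
  obtain ⟨B, hB⟩ : ∃ B : Matrix (Fin r) (Fin r) ℝ, S l = Bᵀ * B := by
    open scoped MatrixOrder in
    obtain ⟨B, hB⟩ := CStarAlgebra.nonneg_iff_eq_star_mul_self.1 (hpsd hl).nonneg
    exact ⟨B, by rw [hB, star_eq_conjTranspose, conjTranspose_eq_transpose_of_trivial]⟩
  have hBdet : IsUnit B.det := by
    rw [isUnit_iff_ne_zero]
    intro h
    rw [hB, det_mul, h, mul_zero] at hpos
    exact hpos.false
  have hz (a : A) : Bᵀ *ᵥ ((Bᵀ)⁻¹ *ᵥ X a) = X a := by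
    rw [mulVec_mulVec, Matrix.mul_nonsing_inv _ (by rwa [det_transpose]), one_mulVec]
  refine ⟨l, B, fun a => (Bᵀ)⁻¹ *ᵥ X a, hl, hBdet, fun y => ?_, hz, fun a => ?_⟩
  · rw [← hquad, hB, ← mulVec_mulVec, dotProduct_mulVec y, vecMul_transpose]
  -- A row of squared norm above `r` would let the determinant grow by shifting mass to it.
  · by_contra! hlt
    obtain ⟨t, ht0, ht1, ht⟩ := exists_one_lt_one_sub_pow_mul hlt
    have hdet := det_smul_gram_add_smul_vecMulVec B ((Bᵀ)⁻¹ *ᵥ X a) ht1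
    rw [hz, ← hB, Fintype.card_fin] at hdet
    have hmem : (1 - t) • l + t • Pi.single a 1 ∈ stdSimplex ℝ A :=
      convex_stdSimplex ℝ A hl (single_mem_stdSimplex ℝ a) (by linarith) ht0.le (by ring)
    have hS : S ((1 - t) • l + t • Pi.single a 1) =
        (1 - t) • S l + t • vecMulVec (X a) (X a) := by
      simp only [S, Pi.add_apply, Pi.smul_apply, add_smul, Finset.sum_add_distrib, smul_eq_mul,
        mul_smul, ← Finset.smul_sum]
      congr 2
      rw [Finset.sum_eq_single a] <;> simp +contextual
    have hle : (S ((1 - t) • l + t • Pi.single a 1)).det ≤ (S l).det := hmax hmem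
    rw [hS, hdet] at hle
    nlinarith

open Matrix in
/-- A real matrix of rank `r` with entries bounded by `D` has `γ₂`-norm at most `D * √r`: after
scaling, its entries are inner products of vectors in the unit ball. -/
theorem Matrix.exists_inner_eq_div_of_rank {A B : Type*} [Fintype A] [Fintype B] [Nonempty A]
    (M : Matrix A B ℝ) {r : ℕ} (hr : M.rank = r) (hr0 : 0 < r) {D : ℝ} (hD : 0 < D)
    (hM : ∀ a b, |M a b| ≤ D) :
    ∃ (u : A → EuclideanSpace ℝ (Fin r)) (v : B → EuclideanSpace ℝ (Fin r)),
      (∀ a, ‖u a‖ ≤ 1) ∧ (∀ b, ‖v b‖ ≤ 1) ∧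
      ∀ a b, inner ℝ (u a) (v b) = M a b / (D * √r) := by
  obtain ⟨X, Y, hXY, hX⟩ := M.exists_rank_factorization hr
  obtain ⟨l, Q, z, hl, -, hQ, hz, hzr⟩ := X.exists_optimal_design hX
  have hsr : 0 < √(r : ℝ) := Real.sqrt_pos.2 (by exact_mod_cast hr0)
  have hnorm (w : Fin r → ℝ) : ‖WithLp.toLp 2 w‖ ^ 2 = w ⬝ᵥ w := by
    rw [EuclideanSpace.real_norm_sq_eq]
    simp [dotProduct, pow_two]
  have hbound {w : Fin r → ℝ} {c : ℝ} (hc : 0 < c) (hw : w ⬝ᵥ w ≤ c ^ 2) :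
      ‖c⁻¹ • WithLp.toLp 2 w‖ ≤ 1 := by
    rw [norm_smul, norm_inv, Real.norm_of_nonneg hc.le, inv_mul_le_one₀ hc]
    exact abs_le_of_sq_le_sq' (by rwa [hnorm]) hc.le |>.2
  have hrow (a : A) (b : B) : X a ⬝ᵥ Yᵀ b = M a b := by rw [hXY]; rfl
  refine ⟨fun a => (√r)⁻¹ • WithLp.toLp 2 (z a), fun b => D⁻¹ • WithLp.toLp 2 (Q *ᵥ Yᵀ b),
    fun a => hbound hsr ?_, fun b => hbound hD ?_, fun a b => ?_⟩
  · rw [Real.sq_sqrt (Nat.cast_nonneg r)]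
    exact hzr a
  -- The squared norm is the `l`-average of the squared entries in column `b`.
  · rw [hQ]
    calc ∑ a, l a * (X a ⬝ᵥ Yᵀ b) ^ 2 ≤ ∑ a, l a * D ^ 2 := by
          refine Finset.sum_le_sum fun a _ => mul_le_mul_of_nonneg_left ?_ (hl.1 a)
          rw [hrow]
          exact sq_le_sq' (abs_le.1 (hM a b)).1 (abs_le.1 (hM a b)).2
      _ = D ^ 2 := by rw [← Finset.sum_mul, hl.2, one_mul]
  · rw [real_inner_smul_left, real_inner_smul_right, EuclideanSpace.inner_toLp_toLp,
      star_trivial, dotProduct_comm, dotProduct_mulVec, ← mulVec_transpose, hz, hrow]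
    field_simp

/-! ### Gaussian rounding -/

open MeasureTheory ProbabilityTheory in
/-- The real part of the characteristic function of the standard Gaussian. -/
theorem integral_cos_inner_stdGaussian {r : ℕ} (t : EuclideanSpace ℝ (Fin r)) :
    ∫ g, Real.cos (inner ℝ g t) ∂(stdGaussian (EuclideanSpace ℝ (Fin r))) =
      Real.exp (-‖t‖ ^ 2 / 2) := by
  have h := charFun_stdGaussian t
  rw [charFun_apply] at h
  have hint : Integrable (fun g => Complex.exp (inner ℝ g t * Complex.I))
      (stdGaussian (EuclideanSpace ℝ (Fin r))) := by
    refine Integrable.of_bound (C := 1) (by fun_prop) (.of_forall fun g => ?_)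
    rw [Complex.norm_exp_ofReal_mul_I]
  have h2 := integral_re hint
  have h3 := congrArg Complex.re h
  simp only [RCLike.re_eq_complex_re] at h2
  rw [← h2] at h3
  simp only [Complex.exp_ofReal_mul_I_re] at h3
  rw [h3]
  norm_cast

/-- Averaging products of phase-shifted cosines over four equidistributed phases. -/
theorem sum_one_add_cos_mul_one_add_cos (α β x y : ℝ) :
    ∑ k : Fin 4, (1 + α * Real.cos (x + k * (Real.pi / 2))) / 2 *
      ((1 + β * Real.cos (y + k * (Real.pi / 2))) / 2) =
      1 + α * β * Real.cos (x - y) / 2 := by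
  have h3 (x : ℝ) : Real.cos (x + 3 * (Real.pi / 2)) = Real.sin x := by
    rw [show x + 3 * (Real.pi / 2) = x + Real.pi / 2 + Real.pi by ring, Real.cos_add_pi,
      Real.cos_add_pi_div_two, neg_neg]
  have h2 (x : ℝ) : Real.cos (x + 2 * (Real.pi / 2)) = -Real.cos x := by
    rw [mul_div_cancel₀ _ (two_ne_zero), Real.cos_add_pi]
  simp only [Fin.sum_univ_four, Fin.val_zero, Fin.val_one, Fin.val_two, Nat.cast_zero,
    Nat.cast_one, Nat.cast_ofNat, zero_mul, add_zero, one_mul, Real.cos_add_pi_div_two,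
    show ((3 : Fin 4) : ℕ) = 3 from rfl, h2, h3, Real.cos_sub]
  ring

/-- The factor by which one round of random rounding scales an entry with inner product `s`. -/
noncomputable def roundingWeight (s : ℝ) : ℝ := (1 + Real.exp (s - 1) / 2) / 4

open MeasureTheory ProbabilityTheory in
/-- One round of random rounding: some pair of `[0, 1]`-valued weight functions does at least as
well as the expectation `roundingWeight`. -/
theorem exists_rounding {A B : Type*} [Fintype A] [Fintype B] {r : ℕ}
    (u : A → EuclideanSpace ℝ (Fin r)) (v : B → EuclideanSpace ℝ (Fin r))
    (hu : ∀ a, ‖u a‖ ≤ 1) (hv : ∀ b, ‖v b‖ ≤ 1) (c : A → B → ℝ) :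
    ∃ (f : A → ℝ) (h : B → ℝ), (∀ a, f a ∈ Set.Icc 0 1) ∧ (∀ b, h b ∈ Set.Icc 0 1) ∧
      ∑ a, ∑ b, c a b * roundingWeight (inner ℝ (u a) (v b)) ≤
        ∑ a, ∑ b, c a b * (f a * h b) := by
  let E := EuclideanSpace ℝ (Fin r)
  -- The squared norms cancel those in `exp (-‖u - v‖ ^ 2 / 2)`, leaving `exp (⟪u, v⟫ - 1)`; the
  -- `-1` keeps `α ≤ 1` on the unit ball.
  let α : E → ℝ := fun w => Real.exp ((‖w‖ ^ 2 - 1) / 2)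
  let φ : E → E → Fin 4 → ℝ := fun w g k =>
    (1 + α w * Real.cos (inner ℝ g w + k * (Real.pi / 2))) / 2
  have hφ {w : E} (hw : ‖w‖ ≤ 1) (g : E) (k : Fin 4) : φ w g k ∈ Set.Icc (0 : ℝ) 1 := by
    have hα : |α w| ≤ 1 := by
      rw [abs_of_pos (Real.exp_pos _), Real.exp_le_one_iff]
      nlinarith [norm_nonneg w]
    have h : |α w * Real.cos (inner ℝ g w + k * (Real.pi / 2))| ≤ 1 := by
      rw [abs_mul]
      exact mul_le_one₀ hα (abs_nonneg _) (Real.abs_cos_le_one _)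
    have := abs_le.1 h
    constructor <;> simp only [φ] <;> linarith [this.1, this.2]
  have hsum (g : E) : ∑ k, ∑ a, ∑ b, c a b * (φ (u a) g k * φ (v b) g k) =
      ∑ a, ∑ b, c a b * (1 + α (u a) * α (v b) * Real.cos (inner ℝ g (u a - v b)) / 2) := by
    rw [Finset.sum_comm]
    refine Finset.sum_congr rfl fun a _ => ?_
    rw [Finset.sum_comm]
    refine Finset.sum_congr rfl fun b _ => ?_
    rw [← Finset.mul_sum, sum_one_add_cos_mul_one_add_cos, inner_sub_right]
  have hcos (t : E) : Integrable (fun g : E => Real.cos (inner ℝ g t)) (stdGaussian E) := by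
    refine Integrable.of_bound (C := 1) (by fun_prop) (.of_forall fun g => ?_)
    exact Real.abs_cos_le_one _
  have hterm (a : A) (b : B) : Integrable (fun g : E =>
      c a b * (1 + α (u a) * α (v b) * Real.cos (inner ℝ g (u a - v b)) / 2)) (stdGaussian E) :=
    ((integrable_const 1).add (((hcos _).const_mul _).div_const _)).const_mul _
  have hexp (a : A) (b : B) :
      ∫ g, c a b * (1 + α (u a) * α (v b) * Real.cos (inner ℝ g (u a - v b)) / 2)
        ∂(stdGaussian E) = 4 * (c a b * roundingWeight (inner ℝ (u a) (v b))) := by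
    rw [integral_const_mul, integral_add (integrable_const 1)
      (((hcos _).const_mul _).div_const _), integral_div, integral_const_mul,
      integral_cos_inner_stdGaussian, integral_const]
    simp only [probReal_univ, smul_eq_mul, mul_one, roundingWeight, α]
    rw [← Real.exp_add, ← Real.exp_add, norm_sub_sq_real]
    ring_nf
  obtain ⟨g, hg⟩ := exists_integral_le (μ := stdGaussian E)
    (f := fun g => ∑ k, ∑ a, ∑ b, c a b * (φ (u a) g k * φ (v b) g k)) (by
      simp only [hsum]
      exact integrable_finsetSum _ fun a _ => integrable_finsetSum _ fun b _ => hterm a b)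
  simp only [hsum] at hg
  rw [integral_finsetSum _ fun a _ => integrable_finsetSum _ fun b _ => hterm a b] at hg
  simp only [integral_finsetSum _ fun b _ => hterm _ b, hexp, ← Finset.mul_sum] at hg
  rw [← hsum] at hg
  obtain ⟨k, -, hk⟩ := Finset.exists_le_of_sum_le (s := (Finset.univ : Finset (Fin 4)))
    (f := fun _ => ∑ a, ∑ b, c a b * roundingWeight (inner ℝ (u a) (v b)))
    (g := fun k => ∑ a, ∑ b, c a b * (φ (u a) g k * φ (v b) g k)) Finset.univ_nonempty
    (by simpa using hg)
  exact ⟨fun a => φ (u a) g k, fun b => φ (v b) g k, fun a => hφ (hu a) g k,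
    fun b => hφ (hv b) g k, hk⟩

/-- Iterated rounding: `T` independent rounds raise the weights to the power `T`. -/
theorem exists_rounding_pow {A B : Type*} [Fintype A] [Fintype B] {r : ℕ}
    (u : A → EuclideanSpace ℝ (Fin r)) (v : B → EuclideanSpace ℝ (Fin r))
    (hu : ∀ a, ‖u a‖ ≤ 1) (hv : ∀ b, ‖v b‖ ≤ 1) (T : ℕ) (c : A → B → ℝ) :
    ∃ (f : A → ℝ) (h : B → ℝ), (∀ a, f a ∈ Set.Icc 0 1) ∧ (∀ b, h b ∈ Set.Icc 0 1) ∧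
      ∑ a, ∑ b, c a b * roundingWeight (inner ℝ (u a) (v b)) ^ T ≤
        ∑ a, ∑ b, c a b * (f a * h b) := by
  induction T generalizing c with
  | zero => exact ⟨1, 1, fun _ => by simp, fun _ => by simp, by simp⟩
  | succ T ih =>
    -- Since `c` is an arbitrary signed matrix, the remaining `T` factors can be absorbed into it.
    obtain ⟨f, h, hf, hh, hle⟩ := exists_rounding u v hu hv
      (fun a b => c a b * roundingWeight (inner ℝ (u a) (v b)) ^ T)
    obtain ⟨f', h', hf', hh', hle'⟩ := ih (fun a b => c a b * (f a * h b))
    refine ⟨f * f', h * h', fun a => ?_, fun b => ?_, ?_⟩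
    · exact ⟨mul_nonneg (hf a).1 (hf' a).1, mul_le_one₀ (hf a).2 (hf' a).1 (hf' a).2⟩
    · exact ⟨mul_nonneg (hh b).1 (hh' b).1, mul_le_one₀ (hh b).2 (hh' b).1 (hh' b).2⟩
    · calc _ = ∑ a, ∑ b, c a b * roundingWeight (inner ℝ (u a) (v b)) ^ T *
            roundingWeight (inner ℝ (u a) (v b)) := by simp only [pow_succ, mul_assoc]
        _ ≤ _ := hle
        _ = ∑ a, ∑ b, c a b * (f a * h b) * roundingWeight (inner ℝ (u a) (v b)) ^ T :=
          Finset.sum_congr rfl fun a _ => Finset.sum_congr rfl fun b _ => by ring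
        _ ≤ _ := hle'
        _ = _ := Finset.sum_congr rfl fun a _ => Finset.sum_congr rfl fun b _ => by
          simp only [Pi.mul_apply]; ring

/-! ### From weights to rectangles -/

/-- A linear form with `[0, 1]`-valued weights is bounded by its value on some subset. -/
theorem exists_finset_sum_mul_le {A : Type*} [Fintype A] (d f : A → ℝ)
    (hf : ∀ a, f a ∈ Set.Icc (0 : ℝ) 1) :
    ∃ A' : Finset A, ∑ a, d a * f a ≤ ∑ a ∈ A', d a := by
  classical
  refine ⟨Finset.univ.filter fun a => 0 ≤ d a, ?_⟩
  rw [Finset.sum_filter]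
  refine Finset.sum_le_sum fun a _ => ?_
  split_ifs with h
  · exact mul_le_of_le_one_right h (hf a).2
  · exact mul_nonpos_of_nonpos_of_nonneg (not_le.1 h).le (hf a).1

/-- A bilinear form with `[0, 1]`-valued weights is bounded by its value on some rectangle. -/
theorem exists_rectangle_sum_mul_le {A B : Type*} [Fintype A] [Fintype B] (c : A → B → ℝ)
    (f : A → ℝ) (h : B → ℝ) (hf : ∀ a, f a ∈ Set.Icc (0 : ℝ) 1)
    (hh : ∀ b, h b ∈ Set.Icc (0 : ℝ) 1) :
    ∃ (A' : Finset A) (B' : Finset B),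
      ∑ a, ∑ b, c a b * (f a * h b) ≤ ∑ a ∈ A', ∑ b ∈ B', c a b := by
  obtain ⟨A', hA⟩ := exists_finset_sum_mul_le (fun a => ∑ b, c a b * h b) f hf
  obtain ⟨B', hB⟩ := exists_finset_sum_mul_le (fun b => ∑ a ∈ A', c a b) h hh
  refine ⟨A', B', ?_⟩
  calc _ = ∑ a, (∑ b, c a b * h b) * f a := by
        simp only [Finset.sum_mul]
        exact Finset.sum_congr rfl fun a _ => Finset.sum_congr rfl fun b _ => by ring
    _ ≤ _ := hA
    _ = ∑ b, (∑ a ∈ A', c a b) * h b := by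
        rw [Finset.sum_comm]
        simp only [Finset.sum_mul]
    _ ≤ _ := hB
    _ = _ := Finset.sum_comm

/-! ### Tilting until one value dominates -/

/-- Separation by tilting: if the rates `ρ` are spread by a factor `S ^ 2`, then for some exponent
`k` of size at most `(Δ + 1) ^ 2` a single value dominates all the others by a factor `S`. -/
theorem exists_dominating_tilt (Δ : ℕ) (p ρ : ℕ → ℝ) {S : ℝ} (hS : 1 ≤ S) (hp : ∀ v, 0 ≤ p v)
    (hρ : ∀ v, 0 < ρ v) (hgap : ∀ v w, v < w → S ^ 2 * ρ v ≤ ρ w) :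
    ∃ k ≤ (Δ + 1) ^ 2, ∃ m ≤ Δ, ∀ v ≤ Δ,
      p v * ρ v ^ k ≤ p m * ρ m ^ k ∧ (v ≠ m → S * (p v * ρ v ^ k) ≤ p m * ρ m ^ k) := by
  classical
  let q : ℕ → ℕ → ℝ := fun k v => p v * ρ v ^ k
  have hq (k v : ℕ) : 0 ≤ q k v := mul_nonneg (hp v) (pow_nonneg (hρ v).le _)
  -- Exponents at which neither value of the pair dominates: their ratio lies strictly between `1 /
  -- S` and `S`. Raising `k` multiplies the ratio by at least `S ^ 2`, so this happens at most once
  -- per pair.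
  let bad : ℕ × ℕ → Finset ℕ := fun e => (Finset.range ((Δ + 1) ^ 2 + 1)).filter fun k =>
    e.1 < e.2 ∧ q k e.1 < S * q k e.2 ∧ q k e.2 < S * q k e.1
  have hstep {v w k k' : ℕ} (hvw : v < w) (hk : k < k') : S ^ 2 * q k w * ρ v ^ (k' - k) ≤
      q k' w := by
    have h1 : S ^ 2 * ρ v ^ (k' - k) ≤ ρ w ^ (k' - k) := by
      have hn : k' - k ≠ 0 := by omega
      calc S ^ 2 * ρ v ^ (k' - k) ≤ (S ^ 2) ^ (k' - k) * ρ v ^ (k' - k) := by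
            have := hρ v
            gcongr
            exact le_self_pow₀ (one_le_pow₀ hS) hn
        _ = (S ^ 2 * ρ v) ^ (k' - k) := (mul_pow _ _ _).symm
        _ ≤ _ := pow_le_pow_left₀ (by have := hρ v; positivity) (hgap v w hvw) _
    calc S ^ 2 * q k w * ρ v ^ (k' - k) = q k w * (S ^ 2 * ρ v ^ (k' - k)) := by ring
      _ ≤ q k w * ρ w ^ (k' - k) := mul_le_mul_of_nonneg_left h1 (hq _ _)
      _ = q k' w := by
        simp only [q]
        rw [mul_assoc, ← pow_add, Nat.add_sub_cancel' hk.le]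
  have hbad (e : ℕ × ℕ) : (bad e).card ≤ 1 := by
    refine Finset.card_le_one.2 ?_
    have key : ∀ k ∈ bad e, ∀ k' ∈ bad e, ¬ k < k' := by
      intro k hk k' hk' hlt
      simp only [bad, Finset.mem_filter] at hk hk'
      have h1 := hstep hk.2.1 hlt
      have hpow : 0 < ρ e.1 ^ (k' - k) := pow_pos (hρ _) _
      have h2 : q k' e.1 = q k e.1 * ρ e.1 ^ (k' - k) := by
        simp only [q]
        rw [mul_assoc, ← pow_add, Nat.add_sub_cancel' hlt.le]
      have h3 := hk'.2.2.2
      rw [h2] at h3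
      have h4 : S * (q k e.1 * ρ e.1 ^ (k' - k)) ≤ S * (S * q k e.2 * ρ e.1 ^ (k' - k)) := by
        have := hk.2.2.1.le
        gcongr
      nlinarith
    intro k hk k' hk'
    exact le_antisymm (not_lt.1 (key k' hk' k hk)) (not_lt.1 (key k hk k' hk'))
  let U := (Finset.range (Δ + 1) ×ˢ Finset.range (Δ + 1)).biUnion bad
  have hU : U.card ≤ (Δ + 1) ^ 2 := by
    refine (Finset.card_biUnion_le_card_mul _ _ 1 fun e _ => hbad e).trans ?_
    simp [pow_two]
  obtain ⟨k, hkr, hkU⟩ := Finset.exists_mem_notMem_of_card_lt_card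
    (s := U) (t := Finset.range ((Δ + 1) ^ 2 + 1)) (by rw [Finset.card_range]; omega)
  obtain ⟨m, hm, hmax⟩ := Finset.exists_max_image (Finset.range (Δ + 1)) (q k) ⟨0, by simp⟩
  have hsep {v w : ℕ} (hv : v ≤ Δ) (hw : w ≤ Δ) (hvw : v < w) :
      S * q k w ≤ q k v ∨ S * q k v ≤ q k w := by
    by_contra! hcon
    refine hkU (Finset.mem_biUnion.2 ⟨(v, w), by simp; omega, ?_⟩)
    exact Finset.mem_filter.2 ⟨hkr, hvw, hcon.1, hcon.2⟩
  have hmΔ : m ≤ Δ := by simpa [Nat.lt_succ_iff] using hm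
  refine ⟨k, by simpa [Nat.lt_succ_iff] using hkr, m, hmΔ, fun v hv => ?_⟩
  have hvm : q k v ≤ q k m := hmax v (by simpa [Nat.lt_succ_iff] using hv)
  refine ⟨hvm, fun hne => ?_⟩
  change S * q k v ≤ q k m
  have hor : S * q k m ≤ q k v ∨ S * q k v ≤ q k m := by
    rcases lt_or_gt_of_ne hne with h | h
    · exact hsep hv hmΔ h
    · exact (hsep hmΔ hv h).symm
  -- If the domination goes the wrong way, maximality of `m` forces equality, and both alternatives
  -- coincide.
  rcases hor with h | h
  · have h5 : q k m ≤ S * q k m := le_mul_of_one_le_left (hq _ _) hS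
    have h6 : q k v = q k m := le_antisymm hvm (h5.trans h)
    rw [h6] at h ⊢
    exact h
  · exact h

/-! ### Estimates for the weights -/

theorem roundingWeight_ge (s : ℝ) : 1 / 4 ≤ roundingWeight s := by
  have := Real.exp_pos (s - 1)
  unfold roundingWeight
  linarith

/-- For `x ≥ 0` the exponential is at least `1 / 3`, so the varying term makes up at least `(1 / 6)
/ (7 / 6) = 1 / 7` of the weight. -/
theorem one_add_div_mul_roundingWeight_le {x y s : ℝ} (hx : 0 ≤ x) (hs : 0 ≤ s)
    (hxy : x + s ≤ y) : (1 + s / 7) * roundingWeight x ≤ roundingWeight y := by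
  have h1 : Real.exp (x - 1) * (1 + s) ≤ Real.exp (y - 1) := by
    calc Real.exp (x - 1) * (1 + s) ≤ Real.exp (x - 1) * Real.exp s := by
          gcongr
          linarith [Real.add_one_le_exp s]
      _ = Real.exp (x - 1 + s) := (Real.exp_add _ _).symm
      _ ≤ _ := Real.exp_le_exp.2 (by linarith)
  have h2 : 1 / 3 ≤ Real.exp (x - 1) := by
    calc (1 / 3 : ℝ) ≤ (Real.exp 1)⁻¹ := by
          rw [one_div]
          exact inv_anti₀ (Real.exp_pos 1) (by linarith [Real.exp_one_lt_d9])
      _ = Real.exp (-1) := (Real.exp_neg 1).symm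
      _ ≤ _ := Real.exp_le_exp.2 (by linarith)
  unfold roundingWeight
  nlinarith

theorem exp_half_le_one_add {x : ℝ} (h0 : 0 ≤ x) (h1 : x ≤ 1) : Real.exp (x / 2) ≤ 1 + x := by
  have h := Real.one_sub_le_exp_neg (x / 2)
  rw [Real.exp_neg] at h
  have hpos := Real.exp_pos (x / 2)
  have h2 : (1 - x / 2) * Real.exp (x / 2) ≤ 1 := by
    calc _ ≤ (Real.exp (x / 2))⁻¹ * Real.exp (x / 2) := by gcongr
      _ = 1 := inv_mul_cancel₀ hpos.ne'
  nlinarith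

/-! ### Scoring the entries and extracting a rectangle -/

/-- Sums over the entries of a bounded matrix, grouped by value. -/
theorem sum_sum_comp_eq_sum_card_mul {A B : Type*} [Fintype A] [Fintype B] {Δ : ℕ}
    (M : Matrix A B ℕ) (hM : ∀ a b, M a b ≤ Δ) (F : ℕ → ℝ) :
    ∑ a, ∑ b, F (M a b) = ∑ v ∈ Finset.range (Δ + 1),
      (((Finset.univ : Finset (A × B)).filter fun e => M e.1 e.2 = v).card : ℝ) * F v := by
  rw [← Fintype.sum_prod_type' fun a b => F (M a b), ← Finset.sum_fiberwise_of_maps_to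
    (s := Finset.univ) (t := Finset.range (Δ + 1)) (g := fun e : A × B => M e.1 e.2)
    (fun e _ => Finset.mem_range.2 (Nat.lt_succ_of_le (hM _ _)))]
  refine Finset.sum_congr rfl fun v _ => ?_
  rw [Finset.sum_congr rfl (g := fun _ => F v) fun e he => by rw [(Finset.mem_filter.1 he).2],
    Finset.sum_const, nsmul_eq_mul]

/-- A rectangle whose `m`-entries outweigh `K` times its other entries is almost monochromatic
and has at least as many entries as the excess. -/
theorem isAlmostMonochromatic_of_le_sum {A B : Type*} (M : Matrix A B ℕ) (A' : Finset A)
    (B' : Finset B) (m : ℕ) {K L : ℝ} (hK : 0 < K) (hL : 0 ≤ L)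
    (h : L ≤ ∑ a ∈ A', ∑ b ∈ B', if M a b = m then 1 else -K) :
    IsAlmostMonochromatic M A' B' (1 / K) ∧ L ≤ (A'.card : ℝ) * B'.card := by
  rw [← Finset.sum_product' A' B' fun a b => if M a b = m then (1 : ℝ) else -K,
    Finset.sum_ite, Finset.sum_const, Finset.sum_const, nsmul_eq_mul, nsmul_eq_mul, mul_one] at h
  have hc := Finset.card_filter_add_card_filter_not (s := A' ×ˢ B') (fun e => M e.1 e.2 = m)
  rw [Finset.card_product] at hc
  have hc' : ((Finset.filter (fun e : A × B => M e.1 e.2 = m) (A' ×ˢ B')).card : ℝ) +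
      (Finset.filter (fun e : A × B => ¬ M e.1 e.2 = m) (A' ×ˢ B')).card =
      (A'.card : ℝ) * B'.card := by exact_mod_cast hc
  set x : ℝ := ((Finset.filter (fun e : A × B => M e.1 e.2 = m) (A' ×ˢ B')).card : ℝ) with hx
  set y : ℝ := ((Finset.filter (fun e : A × B => ¬ M e.1 e.2 = m) (A' ×ˢ B')).card : ℝ)
  have hy0 : 0 ≤ y := Nat.cast_nonneg _
  refine ⟨⟨m, ?_⟩, by nlinarith⟩
  rw [← hx, ← hc', sub_mul, one_mul, one_div, ← div_eq_inv_mul]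
  have : y ≤ (x + y) / K := by
    rw [le_div_iff₀ hK]
    nlinarith
  linarith

/-- Integer matrices whose entries, scaled by `s`, are inner products of vectors in the unit ball
contain large almost monochromatic rectangles. -/
theorem exists_isAlmostMonochromatic_of_inner {A B : Type*} [Fintype A] [Fintype B] {r Δ T₀ : ℕ}
    (M : Matrix A B ℕ) (hM : ∀ a b, M a b ≤ Δ)
    (u : A → EuclideanSpace ℝ (Fin r)) (v : B → EuclideanSpace ℝ (Fin r))
    (hu : ∀ a, ‖u a‖ ≤ 1) (hv : ∀ b, ‖v b‖ ≤ 1) {s : ℝ} (hs : 0 ≤ s)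
    (huv : ∀ a b, inner ℝ (u a) (v b) = M a b * s) {K : ℝ} (hK : 1 ≤ K) (hΔ : 1 ≤ Δ)
    (hT₀ : (2 * K * Δ) ^ 2 ≤ (1 + s / 7) ^ T₀) :
    ∃ (A' : Finset A) (B' : Finset B), IsAlmostMonochromatic M A' B' (1 / K) ∧
      (Fintype.card A : ℝ) * Fintype.card B *
          ((1 / 4) ^ (T₀ * (Δ + 1) ^ 2) / (2 * (Δ + 1))) ≤ (A'.card : ℝ) * B'.card := by
  have hΔ' : (1 : ℝ) ≤ Δ := by exact_mod_cast hΔ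
  let p : ℕ → ℝ := fun v => ((Finset.univ : Finset (A × B)).filter fun e => M e.1 e.2 = v).card
  let w : ℕ → ℝ := fun v => roundingWeight (v * s)
  have hw (v : ℕ) : 1 / 4 ≤ w v := roundingWeight_ge _
  have hw0 (v : ℕ) : 0 < w v := lt_of_lt_of_le (by norm_num) (hw v)
  have hp (v : ℕ) : 0 ≤ p v := Nat.cast_nonneg _
  have hgap (v v' : ℕ) (hvv : v < v') : (2 * K * Δ) ^ 2 * w v ^ T₀ ≤ w v' ^ T₀ := by
    calc (2 * K * Δ) ^ 2 * w v ^ T₀ ≤ (1 + s / 7) ^ T₀ * w v ^ T₀ := by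
          have := hw0 v
          gcongr
      _ = ((1 + s / 7) * w v) ^ T₀ := (mul_pow _ _ _).symm
      _ ≤ w v' ^ T₀ := by
        refine pow_le_pow_left₀ (by have := hw0 v; positivity) ?_ _
        refine one_add_div_mul_roundingWeight_le (by positivity) hs ?_
        have : (v : ℝ) + 1 ≤ v' := by exact_mod_cast hvv
        nlinarith
  -- With `S = 2 * K * Δ`, the `Δ` other values, penalized by `K`, cancel at most half of the
  -- contribution of `m`.
  obtain ⟨k, hk, m, hm, hdom⟩ := exists_dominating_tilt Δ p (fun v => w v ^ T₀)
    (S := 2 * K * Δ) (by nlinarith) hp (fun v => pow_pos (hw0 v) _) hgap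
  simp only [← pow_mul] at hdom
  set T := T₀ * k with hT
  have hq0 (v : ℕ) : 0 ≤ p v * w v ^ T := mul_nonneg (hp v) (pow_nonneg (hw0 v).le _)
  have hmem : m ∈ Finset.range (Δ + 1) := Finset.mem_range.2 (Nat.lt_succ_of_le hm)
  have hcount : (Fintype.card A : ℝ) * Fintype.card B = ∑ v ∈ Finset.range (Δ + 1), p v := by
    have := sum_sum_comp_eq_sum_card_mul M hM fun _ => 1
    simpa using this
  -- The term of `m` is the largest of `Δ + 1`, and every weight is at least `1 / 4`.
  have hlow : (Fintype.card A : ℝ) * Fintype.card B * (1 / 4) ^ (T₀ * (Δ + 1) ^ 2) ≤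
      (Δ + 1) * (p m * w m ^ T) := by
    calc _ = ∑ v ∈ Finset.range (Δ + 1), p v * (1 / 4) ^ (T₀ * (Δ + 1) ^ 2) := by
          rw [hcount, Finset.sum_mul]
      _ ≤ ∑ v ∈ Finset.range (Δ + 1), p m * w m ^ T := by
          refine Finset.sum_le_sum fun v hv => ?_
          refine le_trans ?_ (hdom v (Nat.lt_succ_iff.1 (Finset.mem_range.1 hv))).1
          refine mul_le_mul_of_nonneg_left ?_ (hp v)
          calc (1 / 4 : ℝ) ^ (T₀ * (Δ + 1) ^ 2) ≤ (1 / 4) ^ T :=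
                pow_le_pow_of_le_one (by norm_num) (by norm_num) (Nat.mul_le_mul_left _ hk)
            _ ≤ _ := pow_le_pow_left₀ (by norm_num) (hw v) _
      _ = _ := by simp
  have hmain : p m * w m ^ T / 2 ≤
      ∑ a, ∑ b, (if M a b = m then 1 else -K) * roundingWeight (inner ℝ (u a) (v b)) ^ T := by
    simp only [huv]
    rw [sum_sum_comp_eq_sum_card_mul M hM fun x =>
      (if x = m then 1 else -K) * roundingWeight (x * s) ^ T, ← Finset.add_sum_erase _ _ hmem]
    have herase : -(p m * w m ^ T / 2) ≤ ∑ v ∈ (Finset.range (Δ + 1)).erase m,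
        p v * ((if v = m then 1 else -K) * w v ^ T) := by
      calc -(p m * w m ^ T / 2) = ∑ v ∈ (Finset.range (Δ + 1)).erase m,
            -(p m * w m ^ T / (2 * Δ)) := by
            rw [Finset.sum_const, Finset.card_erase_of_mem hmem, Finset.card_range,
              Nat.add_sub_cancel, nsmul_eq_mul]
            field_simp
        _ ≤ _ := by
            refine Finset.sum_le_sum fun v hv => ?_
            obtain ⟨hvm, hv⟩ := Finset.mem_erase.1 hv
            have h := (hdom v (Nat.lt_succ_iff.1 (Finset.mem_range.1 hv))).2 hvm
            have h2 : K * (p v * w v ^ T) ≤ p m * w m ^ T / (2 * Δ) := by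
              rw [le_div_iff₀ (by positivity)]
              linarith
            rw [if_neg hvm]
            linarith
    simp only [if_true, one_mul]
    change _ ≤ p m * w m ^ T + ∑ v ∈ (Finset.range (Δ + 1)).erase m,
        p v * ((if v = m then 1 else -K) * w v ^ T)
    linarith
  obtain ⟨f, h, hf, hh, hle⟩ := exists_rounding_pow u v hu hv T
    (fun a b => if M a b = m then 1 else -K)
  obtain ⟨A', B', hAB⟩ := exists_rectangle_sum_mul_le
    (fun a b => if M a b = m then 1 else -K) f h hf hh
  obtain ⟨hmono, hsize⟩ := isAlmostMonochromatic_of_le_sum M A' B' m (by linarith)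
    (div_nonneg (hq0 m) zero_le_two) ((hmain.trans hle).trans hAB)
  refine ⟨A', B', hmono, le_trans ?_ hsize⟩
  rw [← mul_div_assoc, div_le_iff₀ (by positivity)]
  linarith

/-! ### Parameters and conclusion -/

/-- The number of rounds and the size loss are absorbed by the exponential factor. -/
theorem exists_rounds {Δ r : ℕ} (hΔ : 1 ≤ Δ) (hr : 2 ≤ r) :
    ∃ T₀ : ℕ, (2 * (16 * (r : ℝ)) * Δ) ^ 2 ≤ (1 + 1 / (Δ * √r) / 7) ^ T₀ ∧
      Real.exp (-(((2000 : ℕ) : ℝ) * (Δ : ℝ) ^ (2000 * Δ) * √r * Real.log r)) ≤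
        (1 / 4) ^ (T₀ * (Δ + 1) ^ 2) / (2 * (Δ + 1)) := by
  have hΔ' : (1 : ℝ) ≤ Δ := by exact_mod_cast hΔ
  have hr' : (2 : ℝ) ≤ r := by exact_mod_cast hr
  have hsq : 1 ≤ √(r : ℝ) := Real.one_le_sqrt.2 (by linarith)
  have hlog2 : 1 / 2 ≤ Real.log 2 := by linarith [Real.log_two_gt_d9]
  have hlog : Real.log 2 ≤ Real.log r := Real.log_le_log (by norm_num) hr'
  set l := Real.log r with hl
  set q := √(r : ℝ) with hq
  have hl0 : 1 / 2 ≤ l := hlog2.trans hlog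
  have hS : Real.log (2 * (16 * (r : ℝ)) * Δ) ≤ 8 * Δ * l := by
    rw [show 2 * (16 * (r : ℝ)) * Δ = 2 ^ 5 * r * Δ by ring,
      Real.log_mul (by positivity) (by positivity), Real.log_mul (by positivity) (by positivity),
      Real.log_pow]
    have := Real.log_le_sub_one_of_pos (show (0 : ℝ) < Δ by linarith)
    push_cast
    nlinarith
  have hη0 : 0 < 1 / (Δ * q) / 7 := by positivity
  have hη1 : 1 / (Δ * q) / 7 ≤ 1 := by
    have : 1 / (Δ * q) ≤ 1 := by
      rw [div_le_one (by positivity)]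
      nlinarith
    linarith
  -- The target exponent is at most `16 * Δ * l`, and each round contributes at least `1 / (14 * Δ *
  -- q)`; `224 = 16 * 14`.
  refine ⟨⌈224 * Δ ^ 2 * q * l⌉₊, ?_, ?_⟩
  · set T := ⌈224 * Δ ^ 2 * q * l⌉₊
    have hT : 224 * Δ ^ 2 * q * l ≤ T := Nat.le_ceil _
    calc (2 * (16 * (r : ℝ)) * Δ) ^ 2 = Real.exp (2 * Real.log (2 * (16 * (r : ℝ)) * Δ)) := by
          rw [two_mul (Real.log _), Real.exp_add, Real.exp_log (by positivity), pow_two]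
      _ ≤ Real.exp (T * (1 / (Δ * q) / 7 / 2)) := by
          refine Real.exp_le_exp.2 ?_
          calc 2 * Real.log (2 * (16 * (r : ℝ)) * Δ) ≤ 2 * (8 * Δ * l) := by linarith
            _ = 224 * Δ ^ 2 * q * l * (1 / (Δ * q) / 7 / 2) := by field_simp; norm_num
            _ ≤ _ := by gcongr
      _ = Real.exp (1 / (Δ * q) / 7 / 2) ^ T := Real.exp_nat_mul _ _
      _ ≤ _ := pow_le_pow_left₀ (Real.exp_pos _).le (exp_half_le_one_add hη0.le hη1) _
  · set T := ⌈224 * Δ ^ 2 * q * l⌉₊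
    have hql : 1 / 2 ≤ q * l := by nlinarith
    have hT : (T : ℝ) ≤ 226 * Δ ^ 2 * (q * l) := by
      have := (Nat.ceil_lt_add_one (show 0 ≤ 224 * (Δ : ℝ) ^ 2 * q * l by positivity)).le
      have : 1 ≤ 2 * Δ ^ 2 * (q * l) := by nlinarith
      linarith
    have h4 : Real.exp (-(2 * ((T * (Δ + 1) ^ 2 : ℕ) : ℝ))) ≤ (1 / 4) ^ (T * (Δ + 1) ^ 2) := by
      rw [show -(2 * ((T * (Δ + 1) ^ 2 : ℕ) : ℝ)) = ((T * (Δ + 1) ^ 2 : ℕ) : ℝ) * (-2) by ring,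
        Real.exp_nat_mul]
      refine pow_le_pow_left₀ (Real.exp_pos _).le ?_ _
      rw [Real.exp_neg, one_div]
      refine inv_anti₀ (by norm_num) ?_
      have h1 : 2 ≤ Real.exp 1 := by linarith [Real.add_one_le_exp (1 : ℝ)]
      rw [show (2 : ℝ) = 1 + 1 by norm_num, Real.exp_add]
      nlinarith
    have hd : Real.exp (-(2 * ((Δ : ℝ) + 1))) ≤ 1 / (2 * (Δ + 1)) := by
      rw [Real.exp_neg, one_div]
      refine inv_anti₀ (by positivity) ?_
      linarith [Real.add_one_le_exp (2 * ((Δ : ℝ) + 1))]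
    rw [div_eq_mul_one_div]
    refine le_trans ?_ (mul_le_mul h4 hd (Real.exp_pos _).le (by positivity))
    rw [← Real.exp_add]
    refine Real.exp_le_exp.2 ?_
    -- A factor `Δ ^ 4` already suffices; the total constant is `2 * 904 + 8 ≤ 2000`.
    have hpow : (Δ : ℝ) ^ 4 ≤ (Δ : ℝ) ^ (2000 * Δ) := pow_le_pow_right₀ hΔ' (by omega)
    have hΔ2 : ((Δ : ℝ) + 1) ^ 2 ≤ 4 * Δ ^ 2 := by nlinarith
    have hTT : (T : ℝ) * (Δ + 1) ^ 2 ≤ 904 * Δ ^ 4 * (q * l) := by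
      calc (T : ℝ) * (Δ + 1) ^ 2 ≤ 226 * Δ ^ 2 * (q * l) * (4 * Δ ^ 2) := by gcongr
        _ = _ := by ring
    have hΔ4 : (Δ : ℝ) ≤ Δ ^ 4 := le_self_pow₀ hΔ' (by norm_num)
    have hlin : 2 * ((Δ : ℝ) + 1) ≤ 8 * Δ ^ 4 * (q * l) := by
      calc 2 * ((Δ : ℝ) + 1) ≤ 8 * Δ ^ 4 * (1 / 2) := by linarith
        _ ≤ _ := by gcongr
    have htot : 2000 * (Δ : ℝ) ^ 4 * (q * l) ≤ 2000 * (Δ : ℝ) ^ (2000 * Δ) * (q * l) := by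
      gcongr
    have hnn : 0 ≤ (Δ : ℝ) ^ 4 * (q * l) := by positivity
    push_cast
    linarith

theorem mainTheorem4 :
    ∃ C : ℕ, 0 < C ∧
      ∀ (A B : Type*) [Fintype A] [Fintype B] (Δ r : ℕ) (M : Matrix A B ℕ),
        (∀ a b, M a b ≤ Δ) →
        (M.map (fun n : ℕ => (n : ℝ))).rank = r →
        2 ≤ r →
        ∃ (A' : Finset A) (B' : Finset B),
          IsAlmostMonochromatic M A' B' (1 / (16 * (r : ℝ))) ∧
          (Fintype.card A : ℝ) * (Fintype.card B : ℝ) *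
              Real.exp (-((C : ℝ) * (Δ : ℝ) ^ (C * Δ) * Real.sqrt r * Real.log r)) ≤
            (A'.card : ℝ) * (B'.card : ℝ) := by
  refine ⟨2000, by norm_num, ?_⟩
  intro A B _ _ Δ r M hM hrank hr
  -- `Δ = 0` would make the matrix zero, against `r ≥ 2`.
  have hΔ : 1 ≤ Δ := by
    by_contra! h
    have hzero : M.map (fun n : ℕ => (n : ℝ)) = 0 := by
      ext a b
      have := hM a b
      simp only [Matrix.map_apply, Matrix.zero_apply, Nat.cast_eq_zero]
      omega
    rw [hzero, Matrix.rank_zero] at hrank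
    omega
  have : Nonempty A := by
    rw [← not_isEmpty_iff]
    intro h
    have := (M.map (fun n : ℕ => (n : ℝ))).rank_le_card_height
    rw [Fintype.card_eq_zero] at this
    omega
  have hΔ' : (0 : ℝ) < Δ := by exact_mod_cast hΔ
  obtain ⟨u, v, hu, hv, huv⟩ := Matrix.exists_inner_eq_div_of_rank _ hrank (by omega) hΔ'
    (fun a b => by
      rw [Matrix.map_apply, Nat.abs_cast]
      exact_mod_cast hM a b)
  obtain ⟨T₀, hT₀, hexp⟩ := exists_rounds hΔ hr
  have hr' : (2 : ℝ) ≤ r := by exact_mod_cast hr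
  obtain ⟨A', B', hmono, hsize⟩ := exists_isAlmostMonochromatic_of_inner M hM u v hu hv
    (s := 1 / (Δ * √r)) (by positivity)
    (fun a b => by rw [huv, Matrix.map_apply, mul_one_div]) (K := 16 * r) (by linarith) hΔ hT₀
  refine ⟨A', B', hmono, le_trans ?_ hsize⟩
  exact mul_le_mul_of_nonneg_left hexp (by positivity)
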